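/- For a measurable function $f:[0,1]\to\mathbb{R}$ and $0\le\delta\le 1$ define $\|f\|_{H^\delta}\in[0,\infty]$ as follows: $\|f\|_{H^0}=\|f\|_{L^2([0,1])}$; for $0<\delta<1$, $$\|f\|_{H^\delta}^2=\iint_{0\le s\le t\le 1}\frac{|f(t)-f(s)|^2}{|t-s|^{1+2\delta}}\,ds\,dt;$$ and $\|f\|_{H^1}^2=\int_0^1|\dot f(t)|^2\,dt$ if there are $\dot f\in L^2([0,1])$ and a constant $a$ with $f(t)=a+\int_0^t\dot f(s)\,ds$ for almost every $t\in[0,1]$, while $\|f\|_{H^1}=\infty$ otherwise. Let $H^\delta$ be the set of measurable $f:[0,1]\to\mathbb{R}$ with $\|f\|_{H^\delta}<\infty$. Let $\tfrac12<\delta\le 1$ and let $B^1,\dots,B^d$ be independent standard real Brownian motions. Then, almost surely, there exists $C>0$ (depending on the realisation) such that $$\forall h\in H^\delta,\qquad \inf_{c\in\mathbb{R}}\ \inf_{\lambda\in\mathbb{R}^d,\ \sum_{i=1}^d\lambda_i^2=1}\ \Big\|\sum_{i=1}^d\lambda_iB^i-h-c\Big\|_{H^{1-\delta}}\ \ge\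 C\,\frac{1}{1+\|h\|_{H^\delta}} .$$ -/

import Mathlib

open MeasureTheory ProbabilityTheory
open scoped NNReal ENNReal

/-- Lebesgue measure on the unit interval `[0,1]`. -/
noncomputable def unitMeasure : Measure ℝ := volume.restrict (Set.Icc (0 : ℝ) 1)

/-- The Sobolev–Slobodeckij seminorm `‖f‖_{H^δ}` on `[0,1]`, for `0 < δ < 1`, with values in
`[0,∞]`: the square root of `∫∫_{0 ≤ s ≤ t ≤ 1} |f t - f s|² / |t - s|^(1 + 2 δ) ds dt`. -/
noncomputable def slobodeckijSeminorm (δ : ℝ) (f : ℝ → ℝ) : ℝ≥0∞ :=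
  (∫⁻ p in {p : ℝ × ℝ | 0 ≤ p.1 ∧ p.1 ≤ p.2 ∧ p.2 ≤ 1},
    ‖f p.2 - f p.1‖ₑ ^ (2 : ℝ) / ‖p.2 - p.1‖ₑ ^ (1 + 2 * δ)) ^ (1 / 2 : ℝ)

/-- `g` is a square-integrable (weak) derivative of `f` on `[0,1]`: `g ∈ L²([0,1])` and
`f` is, up to modification on a null set, a constant plus the primitive of `g`. -/
def IsL2Derivative (f g : ℝ → ℝ) : Prop :=
  MemLp g 2 unitMeasure ∧ ∃ a : ℝ, ∀ᵐ t ∂unitMeasure, f t = a + ∫ s in (0 : ℝ)..t, g s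

/-- The seminorm `‖f‖_{H^1} = ‖f'‖_{L²([0,1])}`, with value `∞` if `f` is not the primitive of a
square-integrable function. The function `f'` is unique up to null sets, so that the infimum
ranges over a single value (or over the empty set). -/
noncomputable def sobolevOneSeminorm (f : ℝ → ℝ) : ℝ≥0∞ :=
  ⨅ (g : ℝ → ℝ) (_ : IsL2Derivative f g), eLpNorm g 2 unitMeasure

/-- `‖f‖_{H^δ}` on `[0,1]` for `0 ≤ δ ≤ 1`, with values in `[0,∞]`: the `L²` norm for `δ = 0`,
the Sobolev–Slobodeckij seminorm for `0 < δ < 1`, and the `L²` norm of the derivative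
for `δ = 1`. -/
noncomputable def sobolevSeminorm (δ : ℝ) (f : ℝ → ℝ) : ℝ≥0∞ :=
  if δ = 0 then eLpNorm f 2 unitMeasure
  else if δ = 1 then sobolevOneSeminorm f
  else slobodeckijSeminorm δ f

/-- `f ∈ H^δ([0,1])`: `f` is (a.e.-)measurable on `[0,1]` and `‖f‖_{H^δ} < ∞`. -/
def MemH (δ : ℝ) (f : ℝ → ℝ) : Prop :=
  AEMeasurable f unitMeasure ∧ sobolevSeminorm δ f < ∞

/-! Brownian paths are rough at every small scale, and this roughness is measured by `incEnergy r`,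
the squared increments with lag at most `r`. For every direction of the unit sphere the energy of
Brownian motion is about `r ^ 2 / 4`. By contrast, it is at most `r ^ (1 + 2 * δ) * ‖h‖ ^ 2` for `h`
in `H^δ`, and at most `4 * r ^ (3 - 2 * δ) * ‖f‖ ^ 2` in terms of the `H^(1-δ)` norm of the
difference `f`. Since the energy ignores constants and is subadditive up to a factor 2, `1 ≤ 16 * r
^ (2 * δ - 1) * ‖h‖ ^ 2 + 64 * r ^ (1 - 2 * δ) * ‖f‖ ^ 2`. As `2 * δ - 1 > 0`, the scale `r ^ (2 * δ
- 1) ~ (1 + ‖h‖) ^ (-2)` makes the first term at most `1/2`, and the second gives `‖f‖ ≥ C / (1 +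
‖h‖)`; this is `exists_le_sobolevSeminorm`.

The probabilistic input is `eventually_le_incEnergy`. The energy is a quadratic form in the
direction, so uniformity over the sphere only requires the finitely many matrix entries to converge
almost surely along dyadic scales. This is a law of large numbers,
`ae_tendsto_setIntegral_shiftRect`, resting on the independence of increments over disjoint
intervals. -/

/-! ### Sobolev bounds on the increment energy -/

/-- The parameters `(s, v)` of the pairs `s ≤ s + v` in `[0,1]` with `s ≤ 1/2` and `v ≤ r`. -/
def shiftRect (r : ℝ) : Set (ℝ × ℝ) := Set.Icc 0 (1 / 2) ×ˢ Set.Icc 0 r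

/-- The squared increments of `f` integrated over `shiftRect r`. -/
noncomputable def incEnergy (r : ℝ) (f : ℝ → ℝ) : ℝ≥0∞ :=
  ∫⁻ p in shiftRect r, ‖f (p.1 + p.2) - f p.1‖ₑ ^ (2 : ℝ)

lemma measurableSet_shiftRect (r : ℝ) : MeasurableSet (shiftRect r) :=
  measurableSet_Icc.prod measurableSet_Icc

lemma restrict_shiftRect (r : ℝ) :
    (volume : Measure (ℝ × ℝ)).restrict (shiftRect r) =
      (volume.restrict (Set.Icc 0 (1 / 2))).prod (volume.restrict (Set.Icc 0 r)) := by
  rw [shiftRect, Measure.prod_restrict]; rfl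

/-- The shear `(s, v) ↦ (s, s + v)` preserves area and, as `r ≤ 1 / 2`, sends the rectangle into the
triangle `s ≤ t ≤ 1`. There the singular kernel is at least `r ^ (-(1 + 2 * δ))`. -/
lemma incEnergy_le_slobodeckijSeminorm {δ r : ℝ} (hδ : 0 < δ) (hr' : r ≤ 1 / 2)
    (f : ℝ → ℝ) :
    incEnergy r f ≤ ENNReal.ofReal (r ^ (1 + 2 * δ)) * slobodeckijSeminorm δ f ^ (2 : ℝ) := by
  have hpow : slobodeckijSeminorm δ f ^ (2 : ℝ) =
      ∫⁻ p in {p : ℝ × ℝ | 0 ≤ p.1 ∧ p.1 ≤ p.2 ∧ p.2 ≤ 1},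
        ‖f p.2 - f p.1‖ₑ ^ (2 : ℝ) / ‖p.2 - p.1‖ₑ ^ (1 + 2 * δ) := by
    rw [slobodeckijSeminorm, ← ENNReal.rpow_mul]; norm_num
  have hmp : MeasurePreserving (fun z : ℝ × ℝ => (z.1, z.1 + z.2)) volume volume :=
    measurePreserving_prod_add (volume : Measure ℝ) (volume : Measure ℝ)
  have hemb : MeasurableEmbedding (fun z : ℝ × ℝ => (z.1, z.1 + z.2)) :=
    (MeasurableEquiv.shearAddRight ℝ).measurableEmbedding
  rw [hpow, ← hmp.setLIntegral_comp_preimage_emb hemb, ← lintegral_const_mul' _ _ (by simp)]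
  calc incEnergy r f ≤ ∫⁻ p in shiftRect r, ENNReal.ofReal (r ^ (1 + 2 * δ)) *
        (‖f (p.1 + p.2) - f p.1‖ₑ ^ (2 : ℝ) / ‖p.1 + p.2 - p.1‖ₑ ^ (1 + 2 * δ)) := by
        refine setLIntegral_mono' (measurableSet_shiftRect r) ?_
        rintro ⟨s, v⟩ ⟨⟨h1, h2⟩, h3, h4⟩
        simp only at h1 h2 h3 h4 ⊢
        rcases h3.eq_or_lt with rfl | h3
        · simp
        have hv : ‖s + v - s‖ₑ = ENNReal.ofReal v := by
          rw [add_sub_cancel_left, Real.enorm_eq_ofReal h3.le]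
        rw [hv, ENNReal.ofReal_rpow_of_pos h3, ← mul_div_assoc, mul_comm, mul_div_assoc]
        have hvp : 0 < v ^ (1 + 2 * δ) := by positivity
        refine le_mul_of_one_le_right (by simp) ?_
        rw [ENNReal.le_div_iff_mul_le (by simp [hvp]) (by simp), one_mul]
        exact ENNReal.ofReal_le_ofReal (Real.rpow_le_rpow h3.le h4 (by linarith))
    _ ≤ _ := by
        refine lintegral_mono_set ?_
        rintro ⟨s, v⟩ ⟨⟨h1, h2⟩, h3, h4⟩
        simp only at h1 h2 h3 h4
        refine ⟨h1, ?_, ?_⟩ <;> simp only <;> linarith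

lemma setLIntegral_comp_add_le {r v : ℝ} (hv : v ∈ Set.Icc 0 r) (hr : r ≤ 1 / 2) (φ : ℝ → ℝ≥0∞) :
    ∫⁻ s in Set.Icc (0 : ℝ) (1 / 2), φ (s + v) ≤ ∫⁻ s, φ s ∂unitMeasure := by
  rw [unitMeasure, ← (measurePreserving_add_right volume v).setLIntegral_comp_preimage_emb
    (measurableEmbedding_addRight v) φ]
  refine lintegral_mono_set ?_
  rintro s ⟨h1, h2⟩
  have := hv.1
  have := hv.2
  constructor <;> simp only <;> linarith

lemma lintegral_shiftRect_add_le {r : ℝ} (hr : r ≤ 1 / 2) {φ : ℝ → ℝ≥0∞} (hφ : Measurable φ) :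
    ∫⁻ p in shiftRect r, φ (p.1 + p.2) ≤ ENNReal.ofReal r * ∫⁻ s, φ s ∂unitMeasure := by
  rw [restrict_shiftRect, lintegral_prod_symm' _ (by fun_prop)]
  calc _ ≤ ∫⁻ _ in Set.Icc 0 r, ∫⁻ s, φ s ∂unitMeasure :=
        setLIntegral_mono' measurableSet_Icc fun v hv => setLIntegral_comp_add_le hv hr φ
    _ = _ := by simp [mul_comm]

lemma lintegral_shiftRect_fst (r : ℝ) {φ : ℝ → ℝ≥0∞} (hφ : Measurable φ) :
    ∫⁻ p in shiftRect r, φ p.1 = ENNReal.ofReal r * ∫⁻ s in Set.Icc (0 : ℝ) (1 / 2), φ s := by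
  rw [restrict_shiftRect, lintegral_prod_symm' _ (by fun_prop)]
  simp [mul_comm]

lemma lintegral_shiftRect_fst_le (r : ℝ) {φ : ℝ → ℝ≥0∞} (hφ : Measurable φ) :
    ∫⁻ p in shiftRect r, φ p.1 ≤ ENNReal.ofReal r * ∫⁻ s, φ s ∂unitMeasure := by
  rw [lintegral_shiftRect_fst r hφ]
  refine mul_le_mul_right ?_ _
  rw [unitMeasure]
  exact lintegral_mono_set (Set.Icc_subset_Icc_right (by norm_num))

/-- Elements of `H^δ` matter only up to null sets; this and its companion for `p.1` show that the
energy does not see such changes. -/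
lemma quasiMeasurePreserving_shiftRect_add {r : ℝ} (hr : r ≤ 1 / 2) :
    Measure.QuasiMeasurePreserving (fun p : ℝ × ℝ => p.1 + p.2)
      (volume.restrict (shiftRect r)) unitMeasure := by
  refine ⟨by fun_prop, Measure.AbsolutelyContinuous.mk fun s hs h0 => ?_⟩
  have h := lintegral_shiftRect_add_le hr (measurable_one.indicator hs : Measurable (s.indicator 1))
  rw [lintegral_indicator_one hs, h0, mul_zero, nonpos_iff_eq_zero] at h
  have hm : MeasurableSet ((fun p : ℝ × ℝ => p.1 + p.2) ⁻¹' s) :=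
    measurableSet_preimage (by fun_prop) hs
  rw [Measure.map_apply (by fun_prop) hs, ← lintegral_indicator_one hm]
  exact h

lemma quasiMeasurePreserving_shiftRect_fst (r : ℝ) :
    Measure.QuasiMeasurePreserving (fun p : ℝ × ℝ => p.1)
      (volume.restrict (shiftRect r)) unitMeasure := by
  refine ⟨by fun_prop, Measure.AbsolutelyContinuous.mk fun s hs h0 => ?_⟩
  have h := lintegral_shiftRect_fst_le r (measurable_one.indicator hs : Measurable (s.indicator 1))
  rw [lintegral_indicator_one hs, h0, mul_zero, nonpos_iff_eq_zero] at h
  have hm : MeasurableSet ((fun p : ℝ × ℝ => p.1) ⁻¹' s) :=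
    measurableSet_preimage (by fun_prop) hs
  rw [Measure.map_apply (by fun_prop) hs, ← lintegral_indicator_one hm]
  exact h

lemma aemeasurable_increment {r : ℝ} (hr : r ≤ 1 / 2) {f : ℝ → ℝ} (hf : AEMeasurable f unitMeasure) :
    AEMeasurable (fun p : ℝ × ℝ => f (p.1 + p.2) - f p.1) (volume.restrict (shiftRect r)) :=
  (hf.comp_quasiMeasurePreserving (quasiMeasurePreserving_shiftRect_add hr)).sub
    (hf.comp_quasiMeasurePreserving (quasiMeasurePreserving_shiftRect_fst r))

lemma incEnergy_congr {r : ℝ} (hr : r ≤ 1 / 2) {f g : ℝ → ℝ} (h : f =ᵐ[unitMeasure] g) :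
    incEnergy r f = incEnergy r g := by
  refine lintegral_congr_ae ?_
  filter_upwards [(quasiMeasurePreserving_shiftRect_add hr).ae h,
    (quasiMeasurePreserving_shiftRect_fst r).ae h] with p h1 h2
  rw [h1, h2]

lemma enorm_add_rpow_two_le (x y : ℝ) :
    ‖x + y‖ₑ ^ (2 : ℝ) ≤ 2 * (‖x‖ₑ ^ (2 : ℝ) + ‖y‖ₑ ^ (2 : ℝ)) := by
  calc ‖x + y‖ₑ ^ (2 : ℝ) ≤ (‖x‖ₑ + ‖y‖ₑ) ^ (2 : ℝ) := by
        gcongr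
        exact enorm_add_le x y
    _ ≤ _ := by
        have := ENNReal.rpow_add_le_mul_rpow_add_rpow ‖x‖ₑ ‖y‖ₑ (p := 2) (by norm_num)
        norm_num at this ⊢
        exact this

lemma eLpNorm_two_rpow {f : ℝ → ℝ} :
    eLpNorm f 2 unitMeasure ^ (2 : ℝ) = ∫⁻ s, ‖f s‖ₑ ^ (2 : ℝ) ∂unitMeasure := by
  rw [eLpNorm_eq_lintegral_rpow_enorm_toReal (by simp) (by simp), ← ENNReal.rpow_mul]
  norm_num

lemma incEnergy_le_eLpNorm {r : ℝ} (hr' : r ≤ 1 / 2) {f : ℝ → ℝ}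
    (hf : AEMeasurable f unitMeasure) :
    incEnergy r f ≤ ENNReal.ofReal (4 * r) * eLpNorm f 2 unitMeasure ^ (2 : ℝ) := by
  rw [incEnergy_congr hr' hf.ae_eq_mk, eLpNorm_congr_ae hf.ae_eq_mk, eLpNorm_two_rpow]
  have hm := hf.measurable_mk
  set g := hf.mk f
  have hφ : Measurable fun s => ‖g s‖ₑ ^ (2 : ℝ) := by fun_prop
  calc incEnergy r g ≤ ∫⁻ p in shiftRect r,
        2 * (‖g (p.1 + p.2)‖ₑ ^ (2 : ℝ) + ‖g p.1‖ₑ ^ (2 : ℝ)) := by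
        refine lintegral_mono fun p => ?_
        have := enorm_add_rpow_two_le (g (p.1 + p.2)) (-g p.1)
        rwa [enorm_neg, ← sub_eq_add_neg] at this
    _ = 2 * ((∫⁻ p in shiftRect r, ‖g (p.1 + p.2)‖ₑ ^ (2 : ℝ)) +
          ∫⁻ p in shiftRect r, ‖g p.1‖ₑ ^ (2 : ℝ)) := by
        rw [lintegral_const_mul' _ _ (by simp), lintegral_add_left (by fun_prop)]
    _ ≤ 2 * (ENNReal.ofReal r * (∫⁻ s, ‖g s‖ₑ ^ (2 : ℝ) ∂unitMeasure) +
          ENNReal.ofReal r * ∫⁻ s, ‖g s‖ₑ ^ (2 : ℝ) ∂unitMeasure) := by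
        gcongr
        · exact lintegral_shiftRect_add_le hr' hφ
        · exact lintegral_shiftRect_fst_le r hφ
    _ = _ := by
        rw [ENNReal.ofReal_mul (by norm_num)]
        norm_num
        ring

/-- Cauchy–Schwarz on `[s, s + v]`; enlarging the interval to `[s, s + r]` makes the bound
independent of `v`. -/
lemma enorm_intervalIntegral_rpow_two_le {g : ℝ → ℝ} (hg : Measurable g) {s v r : ℝ}
    (hv : v ∈ Set.Icc 0 r) :
    ‖∫ u in s..(s + v), g u‖ₑ ^ (2 : ℝ) ≤
      ENNReal.ofReal r * ∫⁻ w in Set.Icc 0 r, ‖g (s + w)‖ₑ ^ (2 : ℝ) := by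
  have hsub : ∫⁻ u in Set.Ioc s (s + v), ‖g u‖ₑ ^ (2 : ℝ) ≤
      ∫⁻ w in Set.Icc 0 r, ‖g (s + w)‖ₑ ^ (2 : ℝ) := by
    rw [← (measurePreserving_add_left volume s).setLIntegral_comp_preimage_emb
      (measurableEmbedding_addLeft s)]
    refine lintegral_mono_set ?_
    rintro w ⟨h1, h2⟩
    have := hv.2
    simp only at h1 h2
    constructor <;> linarith
  have hcs := eLpNorm_le_eLpNorm_mul_rpow_measure_univ (p := 1) (q := 2) (by norm_num)
    (hg.aestronglyMeasurable (μ := volume.restrict (Set.Ioc s (s + v))))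
  calc ‖∫ u in s..(s + v), g u‖ₑ ^ (2 : ℝ)
      ≤ (eLpNorm g 1 (volume.restrict (Set.Ioc s (s + v)))) ^ (2 : ℝ) := by
        rw [intervalIntegral.integral_of_le (by linarith [hv.1]), eLpNorm_one_eq_lintegral_enorm]
        gcongr
        exact enorm_integral_le_lintegral_enorm _
    _ ≤ (eLpNorm g 2 (volume.restrict (Set.Ioc s (s + v))) *
          (ENNReal.ofReal v) ^ (1 / 2 : ℝ)) ^ (2 : ℝ) := by
        refine ENNReal.rpow_le_rpow (hcs.trans_eq ?_) (by norm_num)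
        norm_num
    _ = ENNReal.ofReal v * ∫⁻ u in Set.Ioc s (s + v), ‖g u‖ₑ ^ (2 : ℝ) := by
        rw [ENNReal.mul_rpow_of_nonneg _ _ (by norm_num),
          eLpNorm_eq_lintegral_rpow_enorm_toReal (by simp) (by simp), ← ENNReal.rpow_mul,
          ← ENNReal.rpow_mul, mul_comm]
        norm_num
    _ ≤ _ := by
        gcongr
        exact hv.2

/-- The three powers of `r` come from Cauchy–Schwarz, from the integration over the lag `v`, and
from the average over `w` left by Cauchy–Schwarz. -/
lemma incEnergy_le_of_measurable_isL2Derivative {r : ℝ} (hr : 0 ≤ r) (hr' : r ≤ 1 / 2)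
    {f g : ℝ → ℝ} (hgm : Measurable g) (h : IsL2Derivative f g) :
    incEnergy r f ≤ ENNReal.ofReal (r ^ 3) * eLpNorm g 2 unitMeasure ^ (2 : ℝ) := by
  obtain ⟨hg, a, hfa⟩ := h
  have : IsFiniteMeasure unitMeasure := by unfold unitMeasure; infer_instance
  have hint : IntegrableOn g (Set.Icc 0 1) := (hg.mono_exponent (by norm_num)).integrable le_rfl
  rw [incEnergy_congr hr' hfa, eLpNorm_two_rpow]
  calc _ ≤ ∫⁻ p in shiftRect r,
        ENNReal.ofReal r * ∫⁻ w in Set.Icc 0 r, ‖g (p.1 + w)‖ₑ ^ (2 : ℝ) := by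
        refine setLIntegral_mono' (measurableSet_shiftRect r) ?_
        rintro ⟨s, v⟩ ⟨⟨h1, h2⟩, h34⟩
        obtain ⟨h3, h4⟩ := id h34
        simp only at h1 h2 h3 h4 h34 ⊢
        have key : (a + ∫ u in (0 : ℝ)..(s + v), g u) - (a + ∫ u in (0 : ℝ)..s, g u) =
            ∫ u in s..(s + v), g u := by
          rw [add_sub_add_left_eq_sub, intervalIntegral.integral_interval_sub_left]
          · exact (hint.mono_set (by
              rw [Set.uIcc_of_le (by linarith)]
              exact Set.Icc_subset_Icc_right (by linarith))).intervalIntegrable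
          · exact (hint.mono_set (by
              rw [Set.uIcc_of_le (by linarith)]
              exact Set.Icc_subset_Icc_right (by linarith))).intervalIntegrable
        rw [key]
        exact enorm_intervalIntegral_rpow_two_le hgm h34
    _ = ENNReal.ofReal r * (ENNReal.ofReal r *
          ∫⁻ p in shiftRect r, ‖g (p.1 + p.2)‖ₑ ^ (2 : ℝ)) := by
        have hJ : Measurable fun p : ℝ × ℝ => ‖g (p.1 + p.2)‖ₑ ^ (2 : ℝ) := by fun_prop
        rw [lintegral_const_mul' _ _ (by simp),
          lintegral_shiftRect_fst r (φ := fun s => ∫⁻ w in Set.Icc 0 r, ‖g (s + w)‖ₑ ^ (2 : ℝ))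
            hJ.lintegral_prod_right',
          restrict_shiftRect, lintegral_prod _ hJ.aemeasurable]
    _ ≤ ENNReal.ofReal r * (ENNReal.ofReal r * (ENNReal.ofReal r *
          ∫⁻ s, ‖g s‖ₑ ^ (2 : ℝ) ∂unitMeasure)) := by
        gcongr
        exact lintegral_shiftRect_add_le hr' (φ := fun u => ‖g u‖ₑ ^ (2 : ℝ)) (by fun_prop)
    _ = _ := by
        rw [ENNReal.ofReal_pow hr]
        ring

lemma IsL2Derivative.congr {f g g' : ℝ → ℝ} (h : IsL2Derivative f g) (hg : g =ᵐ[unitMeasure] g') :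
    IsL2Derivative f g' := by
  obtain ⟨h1, a, h2⟩ := h
  refine ⟨h1.ae_eq hg, a, ?_⟩
  have hIcc : ∀ᵐ t ∂unitMeasure, t ∈ Set.Icc (0 : ℝ) 1 := ae_restrict_mem measurableSet_Icc
  have hg' := (ae_restrict_iff' measurableSet_Icc).1 hg
  filter_upwards [h2, hIcc] with t ht ht'
  rw [ht]
  congr 1
  refine intervalIntegral.integral_congr_ae ?_
  filter_upwards [hg'] with u hu hu'
  rw [Set.uIoc_of_le ht'.1] at hu'
  exact hu ⟨hu'.1.le, hu'.2.trans ht'.2⟩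

lemma incEnergy_le_sobolevOneSeminorm {r : ℝ} (hr : 0 < r) (hr' : r ≤ 1 / 2) (f : ℝ → ℝ) :
    incEnergy r f ≤ ENNReal.ofReal (r ^ 3) * sobolevOneSeminorm f ^ (2 : ℝ) := by
  have hr3 : 0 < r ^ 3 := by positivity
  -- Isolating the seminorm turns the claim into a lower bound for an infimum, which also covers the
  -- case of no derivative, where the infimum is `∞`.
  rw [mul_comm, ← ENNReal.div_le_iff_le_mul (by simp [hr3]) (by simp),
    ← ENNReal.rpow_inv_le_iff (by norm_num)]
  refine le_iInf₂ fun g hg => ?_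
  rw [ENNReal.rpow_inv_le_iff (by norm_num), ENNReal.div_le_iff_le_mul (by simp [hr3]) (by simp),
    mul_comm]
  have hm := hg.1.1
  rw [eLpNorm_congr_ae hm.ae_eq_mk]
  exact incEnergy_le_of_measurable_isL2Derivative hr.le hr' hm.stronglyMeasurable_mk.measurable
    (hg.congr hm.ae_eq_mk)

lemma incEnergy_le_sobolevSeminorm {δ r : ℝ} (hδ : 1 / 2 < δ) (hδ' : δ ≤ 1) (hr : 0 < r)
    (hr' : r ≤ 1 / 2) (f : ℝ → ℝ) :
    incEnergy r f ≤ ENNReal.ofReal (r ^ (1 + 2 * δ)) * sobolevSeminorm δ f ^ (2 : ℝ) := by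
  rw [sobolevSeminorm, if_neg (by linarith)]
  split_ifs with h
  · subst h
    convert incEnergy_le_sobolevOneSeminorm hr hr' f using 3
    norm_num
  · exact incEnergy_le_slobodeckijSeminorm (by linarith) hr' f

/-- The factor 4 is needed only at the endpoint `δ = 1`, where the norm is that of `L²`. -/
lemma incEnergy_le_sobolevSeminorm_one_sub {δ r : ℝ} (hδ : 1 / 2 < δ) (hδ' : δ ≤ 1) (hr : 0 < r)
    (hr' : r ≤ 1 / 2) {f : ℝ → ℝ} (hf : AEMeasurable f unitMeasure) :
    incEnergy r f ≤
      ENNReal.ofReal (4 * r ^ (3 - 2 * δ)) * sobolevSeminorm (1 - δ) f ^ (2 : ℝ) := by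
  rw [sobolevSeminorm]
  split_ifs with h h'
  · obtain rfl : δ = 1 := by linarith
    convert incEnergy_le_eLpNorm hr' hf using 4
    norm_num
  · linarith
  · have h1 : 0 < 1 - δ := lt_of_le_of_ne (by linarith) (Ne.symm h)
    refine (incEnergy_le_slobodeckijSeminorm h1 hr' f).trans ?_
    gcongr
    have hp : 0 < r ^ (1 + 2 * (1 - δ)) := by positivity
    rw [show 3 - 2 * δ = 1 + 2 * (1 - δ) by ring]
    linarith

lemma incEnergy_le_add {r c : ℝ} (hr : r ≤ 1 / 2) (b : ℝ → ℝ) {h : ℝ → ℝ}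
    (hh : AEMeasurable h unitMeasure) :
    incEnergy r b ≤ 2 * (incEnergy r h + incEnergy r fun t => b t - h t - c) := by
  rw [incEnergy, incEnergy, incEnergy,
    ← lintegral_add_left' (((aemeasurable_increment hr hh).enorm).pow_const _),
    ← lintegral_const_mul' _ _ (by simp)]
  refine lintegral_mono fun p => ?_
  convert enorm_add_rpow_two_le (h (p.1 + p.2) - h p.1)
    (b (p.1 + p.2) - h (p.1 + p.2) - c - (b p.1 - h p.1 - c)) using 3
  ring

/-! ### Choosing the scale -/

/-- A lower bound of order `r ^ 2` for the increments of `b` at all small dyadic scales `r` bounds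
from below the distance of `b` to every element of `H ^ δ`. -/
lemma exists_le_sobolevSeminorm {δ : ℝ} (hδ : 1 / 2 < δ) (hδ' : δ ≤ 1) (N : ℕ) (hN : 1 ≤ N) :
    ∃ C : ℝ, 0 < C ∧ ∀ b : ℝ → ℝ, AEMeasurable b unitMeasure →
      (∀ n ≥ N, ENNReal.ofReal (((1 / 2) ^ n) ^ 2 / 8) ≤ incEnergy ((1 / 2) ^ n) b) →
      ∀ h : ℝ → ℝ, MemH δ h → ∀ c : ℝ,
        ENNReal.ofReal C * (1 / (1 + sobolevSeminorm δ h)) ≤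
          sobolevSeminorm (1 - δ) fun t => b t - h t - c := by
  set y : ℝ := (1 / 2) ^ (2 * δ - 1) with hy
  have hy0 : 0 < y := by positivity
  have hy1 : y < 1 := Real.rpow_lt_one (by norm_num) (by norm_num) (by linarith)
  refine ⟨√(y * (y ^ N / 32) / 128), by positivity, fun b hb hbN h hh c => ?_⟩
  set f : ℝ → ℝ := fun t => b t - h t - c
  have hfm : AEMeasurable f unitMeasure := (hb.sub hh.1).sub_const c
  rcases eq_or_ne (sobolevSeminorm (1 - δ) f) ∞ with hF | hF
  · rw [hF]; exact le_top
  set H : ℝ := (sobolevSeminorm δ h).toReal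
  set F : ℝ := (sobolevSeminorm (1 - δ) f).toReal
  have hHe : sobolevSeminorm δ h = ENNReal.ofReal H := (ENNReal.ofReal_toReal hh.2.ne).symm
  have hFe : sobolevSeminorm (1 - δ) f = ENNReal.ofReal F := (ENNReal.ofReal_toReal hF).symm
  have hH0 : 0 ≤ H := ENNReal.toReal_nonneg
  have hF0 : 0 ≤ F := ENNReal.toReal_nonneg
  -- The energy inequality divided by `r ^ 2 / 8`, with `r = (1 / 2) ^ n` and `r ^ (2 * δ - 1) = y ^
  -- n`.
  have main : ∀ n ≥ N, 1 ≤ 16 * y ^ n * H ^ 2 + 64 / y ^ n * F ^ 2 := by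
    intro n hn
    set r : ℝ := (1 / 2) ^ n with hrdef
    have hr : 0 < r := by positivity
    have hr' : r ≤ 1 / 2 := pow_le_of_le_one (by norm_num) (by norm_num) (by omega)
    have hry : r ^ (2 * δ - 1) = y ^ n := by
      rw [hrdef, hy, ← Real.rpow_natCast, ← Real.rpow_natCast, ← Real.rpow_mul (by norm_num),
        ← Real.rpow_mul (by norm_num), mul_comm]
    have e1 : r ^ (1 + 2 * δ) = r ^ 2 * y ^ n := by
      rw [← hry, ← Real.rpow_natCast, ← Real.rpow_add hr]; congr 1; push_cast; ring
    have e2 : r ^ (3 - 2 * δ) = r ^ 2 / y ^ n := by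
      rw [← hry, ← Real.rpow_natCast, ← Real.rpow_sub hr]; congr 1; push_cast; ring
    have := (hbN n hn).trans ((incEnergy_le_add (c := c) hr' b hh.1).trans (mul_le_mul_right
      (add_le_add (incEnergy_le_sobolevSeminorm hδ hδ' hr hr' h)
        (incEnergy_le_sobolevSeminorm_one_sub hδ hδ' hr hr' hfm)) 2))
    rw [hHe, hFe, ENNReal.ofReal_rpow_of_nonneg hH0 (by norm_num),
      ENNReal.ofReal_rpow_of_nonneg hF0 (by norm_num), ← ENNReal.ofReal_mul (by positivity),
      ← ENNReal.ofReal_mul (by positivity), ← ENNReal.ofReal_add (by positivity) (by positivity),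
      show (2 : ℝ≥0∞) = ENNReal.ofReal 2 by simp, ← ENNReal.ofReal_mul (by positivity),
      ENNReal.ofReal_le_ofReal_iff (by positivity), e1, e2, Real.rpow_two, Real.rpow_two] at this
    have h2 : r ^ 2 * 1 ≤ r ^ 2 * (16 * y ^ n * H ^ 2 + 64 / y ^ n * F ^ 2) := by
      have : r ^ 2 * (16 * y ^ n * H ^ 2 + 64 / y ^ n * F ^ 2) =
        8 * (2 * (r ^ 2 * y ^ n * H ^ 2 + 4 * (r ^ 2 / y ^ n) * F ^ 2)) := by ring
      linarith
    exact le_of_mul_le_mul_left h2 (by positivity)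
  have hx0 : 0 < y ^ N / (32 * (1 + H) ^ 2) := by positivity
  have hxN : y ^ N / (32 * (1 + H) ^ 2) ≤ y ^ N :=
    div_le_self (by positivity) (by nlinarith)
  -- The scale `n + 1` is the one used: `y ^ (n + 1)` lies below the target, so that the `H` term is
  -- at most `1 / 2`, but above `y` times the target. The factor `y ^ N` in the target forces `n + 1
  -- ≥ N`.
  obtain ⟨n, hn1, hn2⟩ := exists_nat_pow_near_of_lt_one hx0
    (hxN.trans (pow_le_one₀ hy0.le hy1.le)) hy0 hy1
  have hnN : N ≤ n + 1 := by
    by_contra hlt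
    have : y ^ N ≤ y ^ (n + 1) := pow_le_pow_of_le_one hy0.le hy1.le (by omega)
    linarith
  have hm := main (n + 1) hnN
  have hz : 0 < y ^ (n + 1) := by positivity
  have hlow : y * (y ^ N / (32 * (1 + H) ^ 2)) ≤ y ^ (n + 1) := by
    rw [pow_succ' y n]; exact mul_le_mul_of_nonneg_left hn2 hy0.le
  set z := y ^ (n + 1)
  have hzH : 16 * z * H ^ 2 ≤ 1 / 2 := by
    have h1 : z * (32 * (1 + H) ^ 2) ≤ 1 := by
      have := (lt_div_iff₀ (by positivity)).1 hn1
      exact this.le.trans (pow_le_one₀ hy0.le hy1.le)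
    nlinarith
  have hFz : z / 128 ≤ F ^ 2 := by
    have h3 : 1 / 2 ≤ 64 / z * F ^ 2 := by linarith
    have h4 : 64 / z * F ^ 2 * z = 64 * F ^ 2 := by field_simp
    nlinarith [mul_le_mul_of_nonneg_right h3 hz.le]
  rw [hHe, hFe, show (1 : ℝ≥0∞) = ENNReal.ofReal 1 by simp, ← ENNReal.ofReal_add (by simp) hH0,
    ← ENNReal.ofReal_div_of_pos (by linarith), ← ENNReal.ofReal_mul (by positivity)]
  refine ENNReal.ofReal_le_ofReal ?_
  refine abs_le_of_sq_le_sq' ?_ hF0 |>.2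
  refine le_trans (le_of_eq ?_) ((div_le_div_of_nonneg_right hlow (by norm_num)).trans hFz)
  rw [mul_pow, Real.sq_sqrt (by positivity)]
  field_simp

/-! ### Regularising the paths -/

/-- Fubini arguments need joint measurability, obtained from paths that are all continuous. Paths
are set to zero on a null set containing those that are discontinuous or that differ from measurable
versions at some time of a dense sequence; measurability at other times follows by limits. One null
set serves all times. -/
lemma exists_continuous_modification {Ω : Type*} [MeasurableSpace Ω] {P : Measure Ω}
    {B : ℝ≥0 → Ω → ℝ} (hm : ∀ t, AEMeasurable (B t) P) (hc : ∀ᵐ ω ∂P, Continuous (B · ω)) :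
    ∃ W : ℝ≥0 → Ω → ℝ, (∀ ω, Continuous (W · ω)) ∧ (∀ t, Measurable (W t)) ∧
      ∀ᵐ ω ∂P, ∀ t, B t ω = W t ω := by
  classical
  set D : ℕ → ℝ≥0 := TopologicalSpace.denseSeq ℝ≥0
  have hgood : ∀ᵐ ω ∂P, Continuous (B · ω) ∧ ∀ n, B (D n) ω = (hm (D n)).mk _ ω :=
    hc.and (ae_all_iff.2 fun n => (hm (D n)).ae_eq_mk)
  obtain ⟨s, hsub, hs, hs0⟩ := exists_measurable_superset_of_null (ae_iff.1 hgood)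
  have hgs : ∀ ω ∉ s, Continuous (B · ω) ∧ ∀ n, B (D n) ω = (hm (D n)).mk _ ω := by
    intro ω hω
    by_contra hcon
    exact hω (hsub hcon)
  have hW0 : ∀ t ω, ω ∉ s → sᶜ.indicator (B t) ω = B t ω := fun t ω h =>
    Set.indicator_of_mem (by simpa using h) _
  have hW1 : ∀ t ω, ω ∈ s → sᶜ.indicator (B t) ω = 0 := fun t ω h =>
    Set.indicator_of_notMem (by simpa using h) _
  have hcont : ∀ ω, Continuous fun t => sᶜ.indicator (B t) ω := by
    intro ω
    by_cases h : ω ∈ s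
    · simp_rw [fun t => hW1 t ω h]; exact continuous_const
    · simp_rw [fun t => hW0 t ω h]; exact (hgs ω h).1
  refine ⟨fun t => sᶜ.indicator (B t), hcont, fun t => ?_, ?_⟩
  · have hmem : t ∈ closure (Set.range D) := TopologicalSpace.denseRange_denseSeq ℝ≥0 t
    obtain ⟨x, hx, hxt⟩ := mem_closure_iff_seq_limit.1 hmem
    refine measurable_of_tendsto_metrizable (f := fun n => sᶜ.indicator (B (x n))) (fun n => ?_)
      (tendsto_pi_nhds.2 fun ω => ((hcont ω).tendsto t).comp hxt)
    obtain ⟨k, hk⟩ := hx n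
    have : sᶜ.indicator (B (x n)) = sᶜ.indicator ((hm (D k)).mk _) := by
      ext ω
      by_cases h : ω ∈ s
      · rw [hW1 _ _ h, Set.indicator_of_notMem (by simpa using h)]
      · rw [hW0 _ _ h, Set.indicator_of_mem (by simpa using h), ← hk, (hgs ω h).2]
    rw [this]
    exact (hm (D k)).measurable_mk.indicator hs.compl
  · filter_upwards [measure_eq_zero_iff_ae_notMem.1 hs0] with ω h t
    exact (hW0 t ω h).symm

/-! ### A law of large numbers over dyadic scales -/

/-- A second moment bound for the integral of a process which is uncorrelated off a set `N`. -/
lemma lintegral_sq_integral_le {Ω E : Type*} [MeasurableSpace Ω] [MeasurableSpace E]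
    (P : Measure Ω) [IsProbabilityMeasure P] (μ : Measure E) [IsFiniteMeasure μ]
    {Z : E → Ω → ℝ} (hZ : Measurable (Function.uncurry Z)) {K : ℝ} {N : Set (E × E)}
    (hN : MeasurableSet N) (hmem : ∀ᵐ p ∂μ, MemLp (Z p) 2 P ∧ ∫ ω, Z p ω ^ 2 ∂P ≤ K)
    (hcov : ∀ᵐ z ∂μ.prod μ, z ∉ N → ∫ ω, Z z.1 ω * Z z.2 ω ∂P = 0) :
    ∫⁻ ω, ENNReal.ofReal ((∫ p, Z p ω ∂μ) ^ 2) ∂P ≤ ENNReal.ofReal (K * (μ.prod μ).real N) := by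
  set G : (E × E) × Ω → ℝ := fun x => Z x.1.1 x.2 * Z x.1.2 x.2 with hG
  have hGm : Measurable G :=
    (hZ.comp (f := fun x : (E × E) × Ω => (x.1.1, x.2)) (by fun_prop)).mul
      (hZ.comp (f := fun x : (E × E) × Ω => (x.1.2, x.2)) (by fun_prop))
  have hbound : ∀ᵐ z ∂μ.prod μ, Integrable (fun ω => G (z, ω)) P ∧ ∫ ω, ‖G (z, ω)‖ ∂P ≤ K := by
    filter_upwards [Measure.quasiMeasurePreserving_fst.ae hmem,
      Measure.quasiMeasurePreserving_snd.ae hmem] with z h1 h2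
    have hi : Integrable (fun ω => G (z, ω)) P := h1.1.integrable_mul h2.1
    refine ⟨hi, ?_⟩
    calc ∫ ω, ‖G (z, ω)‖ ∂P ≤ ∫ ω, (Z z.1 ω ^ 2 + Z z.2 ω ^ 2) / 2 ∂P := by
          refine integral_mono hi.norm ((h1.1.integrable_sq.add h2.1.integrable_sq).div_const 2)
            fun ω => ?_
          simp only [hG, Real.norm_eq_abs, abs_mul]
          nlinarith [sq_nonneg (|Z z.1 ω| - |Z z.2 ω|), sq_abs (Z z.1 ω), sq_abs (Z z.2 ω)]
      _ ≤ K := by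
          rw [integral_div, integral_add h1.1.integrable_sq h2.1.integrable_sq]
          linarith [h1.2, h2.2]
  have hGi : Integrable G ((μ.prod μ).prod P) := by
    refine (integrable_prod_iff hGm.aestronglyMeasurable).2 ⟨hbound.mono fun _ h => h.1, ?_⟩
    refine Integrable.of_bound (C := K)
      (hGm.norm.stronglyMeasurable.integral_prod_right').aestronglyMeasurable ?_
    filter_upwards [hbound] with z hz
    rw [Real.norm_of_nonneg (integral_nonneg fun _ => norm_nonneg _)]
    exact hz.2
  -- The square of the integral is a double integral; after Fubini its integrand is the correlation
  -- of `Z p` and `Z q`, which vanishes off `N` and is at most `K` on it.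
  have hsq : ∀ ω, (∫ p, Z p ω ∂μ) ^ 2 = ∫ z, G (z, ω) ∂μ.prod μ := fun ω => by
    rw [sq, ← integral_prod_mul]
  simp_rw [hsq]
  rw [← ofReal_integral_eq_lintegral_ofReal hGi.integral_prod_right
    (ae_of_all _ fun ω => (sq_nonneg _).trans_eq (hsq ω))]
  refine ENNReal.ofReal_le_ofReal ?_
  rw [integral_integral_swap (f := fun ω z => G (z, ω)) hGi.swap]
  calc ∫ z, ∫ ω, G (z, ω) ∂P ∂μ.prod μ ≤ ∫ z, N.indicator (fun _ => K) z ∂μ.prod μ := by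
        refine integral_mono_ae hGi.integral_prod_left
          ((integrable_const K).indicator hN) ?_
        filter_upwards [hcov, hbound] with z h1 h2
        by_cases hz : z ∈ N
        · rw [Set.indicator_of_mem hz]
          exact ((le_abs_self _).trans (norm_integral_le_integral_norm (fun ω => G (z, ω)))).trans h2.2
        · rw [Set.indicator_of_notMem hz]
          exact (h1 hz).le
    _ = _ := by rw [integral_indicator_const _ hN, smul_eq_mul, mul_comm]

lemma volume_shiftRect (r : ℝ) :
    (volume : Measure (ℝ × ℝ)) (shiftRect r) = ENNReal.ofReal (r / 2) := by
  rw [shiftRect, Measure.volume_eq_prod, Measure.prod_prod, Real.volume_Icc, Real.volume_Icc,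
    ← ENNReal.ofReal_mul (by norm_num)]
  congr 1; ring

instance isFiniteMeasure_restrict_shiftRect (r : ℝ) :
    IsFiniteMeasure ((volume : Measure (ℝ × ℝ)).restrict (shiftRect r)) := by
  rw [restrict_shiftRect]; infer_instance

lemma measurableSet_near (r : ℝ) :
    MeasurableSet {z : (ℝ × ℝ) × (ℝ × ℝ) | |z.1.1 - z.2.1| ≤ r} :=
  measurableSet_le (by fun_prop) measurable_const

/-- For fixed `p`, the admissible `q` lie in a rectangle of area `2 * r * r`; the rectangle of `p`
has area `r / 2`. -/
lemma prod_restrict_shiftRect_near_le {r : ℝ} (hr : 0 ≤ r) :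
    ((volume.restrict (shiftRect r)).prod (volume.restrict (shiftRect r))).real
      {z : (ℝ × ℝ) × (ℝ × ℝ) | |z.1.1 - z.2.1| ≤ r} ≤ r ^ 3 := by
  refine ENNReal.toReal_le_of_le_ofReal (by positivity) ?_
  rw [Measure.prod_apply (measurableSet_near r)]
  calc _ ≤ ∫⁻ _ in shiftRect r, ENNReal.ofReal (2 * r * r) := by
        refine lintegral_mono fun p => ?_
        have hm : MeasurableSet (Prod.mk p ⁻¹'
            {z : (ℝ × ℝ) × (ℝ × ℝ) | |z.1.1 - z.2.1| ≤ r}) :=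
          measurableSet_preimage (by fun_prop) (measurableSet_near r)
        rw [Measure.restrict_apply hm]
        calc _ ≤ volume (Set.Icc (p.1 - r) (p.1 + r) ×ˢ Set.Icc 0 r) := by
              refine measure_mono ?_
              rintro q ⟨h1, h2⟩
              have h1' : |p.1 - q.1| ≤ r := h1
              rw [abs_le] at h1'
              exact ⟨⟨by linarith [h1'.2], by linarith [h1'.1]⟩, h2.2⟩
          _ = _ := by
              rw [Measure.volume_eq_prod, Measure.prod_prod, Real.volume_Icc, Real.volume_Icc,
                ← ENNReal.ofReal_mul (by linarith)]
              congr 1; ring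
    _ = ENNReal.ofReal (r ^ 3) := by
        rw [setLIntegral_const, volume_shiftRect, ← ENNReal.ofReal_mul (by positivity)]
        congr 1; ring

/-- A law of large numbers for processes indexed by `(s, v)` which are uncorrelated at pairs
of indices whose intervals `[s, s + v]` are far apart. -/
lemma ae_tendsto_setIntegral_shiftRect {Ω : Type*} [MeasurableSpace Ω] (P : Measure Ω)
    [IsProbabilityMeasure P] {Z : ℝ × ℝ → Ω → ℝ} (hZ : Measurable (Function.uncurry Z)) {K : ℝ}
    (hK : 0 ≤ K)
    (hmem : ∀ r, ∀ p ∈ shiftRect r, MemLp (Z p) 2 P ∧ ∫ ω, Z p ω ^ 2 ∂P ≤ K * r ^ 2)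
    (hcov : ∀ r, ∀ p ∈ shiftRect r, ∀ q ∈ shiftRect r, r < |p.1 - q.1| →
      ∫ ω, Z p ω * Z q ω ∂P = 0) :
    ∀ᵐ ω ∂P, Filter.Tendsto
      (fun n : ℕ => (∫ p in shiftRect ((1 / 2) ^ n), Z p ω) / ((1 / 2) ^ n) ^ 2)
      Filter.atTop (nhds 0) := by
  set Y : ℕ → Ω → ℝ :=
    fun n ω => (∫ p in shiftRect ((1 / 2) ^ n), Z p ω) / ((1 / 2) ^ n) ^ 2 with hY
  have hYm : ∀ n, Measurable (Y n) := fun n =>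
    (hZ.stronglyMeasurable.integral_prod_left
      (μ := volume.restrict (shiftRect ((1 / 2) ^ n)))).measurable.div_const _
  -- The second moment is at most `K * r ^ 2 * r ^ 3 / r ^ 4 = K * r`, which is summable over dyadic
  -- `r`. Hence `∑ Y n ^ 2` is almost surely finite and its terms tend to zero.
  have hbound : ∀ n, ∫⁻ ω, ENNReal.ofReal (Y n ω ^ 2) ∂P ≤ ENNReal.ofReal (K * (1 / 2) ^ n) := by
    intro n
    set r : ℝ := (1 / 2) ^ n with hr
    have hr0 : 0 < r := by positivity
    have key := lintegral_sq_integral_le P (volume.restrict (shiftRect r)) hZ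
      (K := K * r ^ 2) (measurableSet_near r)
      (ae_restrict_of_forall_mem (measurableSet_shiftRect r) (hmem r)) (by
        rw [Measure.prod_restrict]
        refine ae_restrict_of_forall_mem
          ((measurableSet_shiftRect r).prod (measurableSet_shiftRect r)) ?_
        rintro ⟨p, q⟩ ⟨hp, hq⟩ hpq
        exact hcov r p hp q hq (not_le.1 hpq))
    calc ∫⁻ ω, ENNReal.ofReal (Y n ω ^ 2) ∂P
        = ∫⁻ ω, ENNReal.ofReal ((r ^ 4)⁻¹) *
            ENNReal.ofReal ((∫ p in shiftRect r, Z p ω) ^ 2) ∂P := by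
          refine lintegral_congr fun ω => ?_
          rw [← ENNReal.ofReal_mul (by positivity)]
          congr 1
          simp only [hY, ← hr]
          field_simp
      _ ≤ ENNReal.ofReal ((r ^ 4)⁻¹) * ENNReal.ofReal (K * r ^ 2 * r ^ 3) := by
          rw [lintegral_const_mul' _ _ (by simp)]
          refine mul_le_mul_right (key.trans (ENNReal.ofReal_le_ofReal ?_)) _
          exact mul_le_mul_of_nonneg_left (prod_restrict_shiftRect_near_le hr0.le) (by positivity)
      _ = _ := by
          rw [← ENNReal.ofReal_mul (by positivity)]
          congr 1
          field_simp
  have hsum : ∑' n : ℕ, ENNReal.ofReal (K * (1 / 2) ^ n) ≠ ∞ := by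
    have hs : Summable fun n : ℕ => K * (1 / 2 : ℝ) ^ n := summable_geometric_two.mul_left K
    exact hs.tsum_ofReal_ne_top
  have hfin : ∫⁻ ω, ∑' n, ENNReal.ofReal (Y n ω ^ 2) ∂P ≠ ∞ := by
    rw [lintegral_tsum fun n => ((hYm n).pow_const 2).ennreal_ofReal.aemeasurable]
    exact ne_top_of_le_ne_top hsum (ENNReal.tsum_le_tsum hbound)
  filter_upwards [ae_lt_top' (AEMeasurable.tsum
    fun n => ((hYm n).pow_const 2).ennreal_ofReal.aemeasurable) hfin] with ω hω
  have h0 := ENNReal.tendsto_atTop_zero_of_tsum_ne_top hω.ne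
  have h1 := (ENNReal.tendsto_toReal ENNReal.zero_ne_top).comp h0
  have h2 : Filter.Tendsto (fun n => Y n ω ^ 2) Filter.atTop (nhds 0) := by
    refine h1.congr fun n => ?_
    simp [ENNReal.toReal_ofReal (sq_nonneg _)]
  have h3 := h2.sqrt
  simp only [Real.sqrt_sq_eq_abs, Real.sqrt_zero] at h3
  exact (tendsto_zero_iff_abs_tendsto_zero _).2 h3

/-! ### Gaussian moments -/

section Gaussian

variable {Ω : Type*} [MeasurableSpace Ω] {P : Measure Ω} {X : Ω → ℝ} {v : ℝ≥0}

lemma memLp_of_hasLaw_gaussianReal (hX : HasLaw X (gaussianReal 0 v) P) (p : ℝ≥0) :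
    MemLp X p P := by
  have h := memLp_id_gaussianReal (μ := 0) (v := v) p
  rw [← hX.map_eq, memLp_map_measure_iff aestronglyMeasurable_id hX.aemeasurable] at h
  exact h

lemma integrable_pow_of_hasLaw_gaussianReal [IsFiniteMeasure P]
    (hX : HasLaw X (gaussianReal 0 v) P) (n : ℕ) : Integrable (fun ω => X ω ^ n) P := by
  have h := (memLp_of_hasLaw_gaussianReal hX n).integrable_norm_pow'
  simp_rw [← norm_pow] at h
  exact (integrable_norm_iff (hX.aemeasurable.pow_const n).aestronglyMeasurable).1 h

lemma integral_of_hasLaw_gaussianReal (hX : HasLaw X (gaussianReal 0 v) P) :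
    ∫ ω, X ω ∂P = 0 := by
  rw [hX.integral_eq, integral_id_gaussianReal]

lemma integral_sq_of_hasLaw_gaussianReal (hX : HasLaw X (gaussianReal 0 v) P) :
    ∫ ω, X ω ^ 2 ∂P = v := by
  have h := hX.variance_eq
  rwa [variance_id_gaussianReal, variance_of_integral_eq_zero hX.aemeasurable
    (integral_of_hasLaw_gaussianReal hX)] at h

/-- The variance of the square of a standard Gaussian variable. -/
noncomputable def gaussianSqVar : ℝ := ∫ x, (x ^ 2 - 1) ^ 2 ∂gaussianReal 0 1

lemma gaussianSqVar_nonneg : 0 ≤ gaussianSqVar := integral_nonneg fun _ => sq_nonneg _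

lemma integral_sq_sub_sq_of_hasLaw_gaussianReal (hX : HasLaw X (gaussianReal 0 v) P) :
    ∫ ω, (X ω ^ 2 - v) ^ 2 ∂P = gaussianSqVar * (v : ℝ) ^ 2 := by
  have hmap : (gaussianReal 0 1).map (fun x => √v * x) = gaussianReal 0 v := by
    rw [gaussianReal_map_const_mul]
    congr 1
    · simp
    · ext; simp
  have h1 := hX.integral_comp (f := fun x => (x ^ 2 - (v : ℝ)) ^ 2)
    (by fun_prop : Measurable _).aestronglyMeasurable
  refine h1.trans ?_
  rw [← hmap, integral_map (by fun_prop) (by fun_prop : Measurable _).aestronglyMeasurable,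
    gaussianSqVar, ← integral_mul_const]
  refine integral_congr_ae (ae_of_all _ fun x => ?_)
  simp only [mul_pow, Real.sq_sqrt (NNReal.coe_nonneg v)]
  ring

lemma memLp_sq_sub_of_hasLaw_gaussianReal [IsFiniteMeasure P]
    (hX : HasLaw X (gaussianReal 0 v) P) : MemLp (fun ω => X ω ^ 2 - (v : ℝ)) 2 P := by
  rw [memLp_two_iff_integrable_sq ((hX.aemeasurable.pow_const 2).sub_const _).aestronglyMeasurable]
  have h := ((integrable_pow_of_hasLaw_gaussianReal hX 4).sub
    ((integrable_pow_of_hasLaw_gaussianReal hX 2).const_mul (2 * v))).add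
      (integrable_const ((v : ℝ) ^ 2))
  refine h.congr (ae_of_all _ fun ω => ?_)
  simp only [Pi.add_apply, Pi.sub_apply]
  ring

end Gaussian

/-! ### Correlations of Brownian increments -/

/-- The increment of `W` over the interval `[s, s + v]`, where `p = (s, v)`. -/
def increment {Ω : Type*} (W : ℝ≥0 → Ω → ℝ) (p : ℝ × ℝ) (ω : Ω) : ℝ :=
  W (p.1 + p.2).toNNReal ω - W p.1.toNNReal ω

lemma continuous_increment {Ω : Type*} {W : ℝ≥0 → Ω → ℝ} {ω : Ω} (hc : Continuous (W · ω)) :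
    Continuous fun p => increment W p ω :=
  (hc.comp (by fun_prop : Continuous fun p : ℝ × ℝ => (p.1 + p.2).toNNReal)).sub
    (hc.comp (by fun_prop : Continuous fun p : ℝ × ℝ => p.1.toNNReal))

section Increments

variable {Ω : Type*} [MeasurableSpace Ω] {P : Measure Ω}

lemma measurable_uncurry_increment {W : ℝ≥0 → Ω → ℝ} (hc : ∀ ω, Continuous (W · ω))
    (hm : ∀ t, Measurable (W t)) : Measurable (Function.uncurry (increment W)) := by
  have hW := measurable_uncurry_of_continuous_of_measurable hc hm
  exact (hW.comp (f := fun x : (ℝ × ℝ) × Ω => ((x.1.1 + x.1.2).toNNReal, x.2)) (by fun_prop)).sub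
    (hW.comp (f := fun x : (ℝ × ℝ) × Ω => (x.1.1.toNNReal, x.2)) (by fun_prop))

lemma hasLaw_increment {W : ℝ≥0 → Ω → ℝ} (hW : IsPreBrownianReal W P) {r : ℝ} {p : ℝ × ℝ}
    (hp : p ∈ shiftRect r) : HasLaw (increment W p) (gaussianReal 0 p.2.toNNReal) P := by
  obtain ⟨⟨h1, -⟩, h2, -⟩ := hp
  have hv : p.2.toNNReal = nndist ((p.1 + p.2).toNNReal : ℝ) (p.1.toNNReal : ℝ) := by
    ext
    rw [coe_nndist, Real.dist_eq, Real.coe_toNNReal _ h1, Real.coe_toNNReal _ h2,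
      Real.coe_toNNReal _ (add_nonneg h1 h2), add_sub_cancel_left, abs_of_nonneg h2]
  rw [hv]
  exact hW.hasLaw_sub _ _

lemma indepFun_increment {W : ℝ≥0 → Ω → ℝ} (hW : IsPreBrownianReal W P) {p q : ℝ × ℝ}
    (hp : 0 ≤ p.2) (hq : 0 ≤ q.2) (hpq : p.1 + p.2 ≤ q.1) :
    IndepFun (increment W p) (increment W q) P := by
  -- The two increments are numbers 0 and 2 of this monotone sequence; number 1 is the gap between
  -- the intervals.
  let τ : ℕ → ℝ≥0
    | 0 => p.1.toNNReal
    | 1 => (p.1 + p.2).toNNReal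
    | 2 => q.1.toNNReal
    | _ => (q.1 + q.2).toNNReal
  have hτ : Monotone τ := by
    refine monotone_nat_of_le_succ fun n => ?_
    match n with
    | 0 => exact Real.toNNReal_le_toNNReal (by linarith)
    | 1 => exact Real.toNNReal_le_toNNReal hpq
    | 2 => exact Real.toNNReal_le_toNNReal (by linarith)
    | n + 3 => exact le_rfl
  exact (hW.hasIndepIncrements.nat hτ).indepFun (show (0 : ℕ) ≠ 2 by norm_num)

lemma integral_increment_mul {W : ℝ≥0 → Ω → ℝ} (hW : IsPreBrownianReal W P) {r : ℝ}
    {p q : ℝ × ℝ} (hp : p ∈ shiftRect r) (hq : q ∈ shiftRect r) (hpq : p.1 + p.2 ≤ q.1) :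
    ∫ ω, increment W p ω * increment W q ω ∂P = 0 := by
  have h := (indepFun_increment hW hp.2.1 hq.2.1 hpq).integral_mul_eq_mul_integral
    (hasLaw_increment hW hp).aemeasurable.aestronglyMeasurable
    (hasLaw_increment hW hq).aemeasurable.aestronglyMeasurable
  rw [integral_of_hasLaw_gaussianReal (hasLaw_increment hW hp), zero_mul] at h
  exact h

lemma integral_increment_sq_sub_mul [IsProbabilityMeasure P] {W : ℝ≥0 → Ω → ℝ}
    (hW : IsPreBrownianReal W P) {r : ℝ}
    {p q : ℝ × ℝ} (hp : p ∈ shiftRect r) (hq : q ∈ shiftRect r) (hpq : p.1 + p.2 ≤ q.1) :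
    ∫ ω, (increment W p ω ^ 2 - p.2) * (increment W q ω ^ 2 - q.2) ∂P = 0 := by
  have hlp := hasLaw_increment hW hp
  have hlq := hasLaw_increment hW hq
  have h := ((indepFun_increment hW hp.2.1 hq.2.1 hpq).comp
    (by fun_prop : Measurable fun x : ℝ => x ^ 2 - p.2)
    (by fun_prop : Measurable fun x : ℝ => x ^ 2 - q.2)).integral_mul_eq_mul_integral
    ((hlp.aemeasurable.pow_const 2).sub_const p.2).aestronglyMeasurable
    ((hlq.aemeasurable.pow_const 2).sub_const q.2).aestronglyMeasurable
  have h0 : ∫ ω, (increment W p ω ^ 2 - p.2) ∂P = 0 := by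
    rw [integral_sub (integrable_pow_of_hasLaw_gaussianReal hlp 2) (integrable_const _),
      integral_sq_of_hasLaw_gaussianReal hlp, Real.coe_toNNReal _ hp.2.1]
    simp
  refine h.trans ?_
  exact mul_eq_zero_of_left h0 _

lemma add_le_or_add_le_of_mem_shiftRect {r : ℝ} {p q : ℝ × ℝ} (hp : p ∈ shiftRect r)
    (hq : q ∈ shiftRect r) (h : r < |p.1 - q.1|) : p.1 + p.2 ≤ q.1 ∨ q.1 + q.2 ≤ p.1 := by
  have := hp.2.2
  have := hq.2.2
  rcases lt_abs.1 h with h | h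
  · right; linarith
  · left; linarith

/-- Diagonal entries of the quadratic form: squared increments centred by their variance `p.2`. -/
lemma ae_tendsto_setIntegral_increment_sq [IsProbabilityMeasure P] {W : ℝ≥0 → Ω → ℝ}
    (hW : IsPreBrownianReal W P) (hc : ∀ ω, Continuous (W · ω)) (hm : ∀ t, Measurable (W t)) :
    ∀ᵐ ω ∂P, Filter.Tendsto
      (fun n : ℕ => (∫ p in shiftRect ((1 / 2) ^ n), (increment W p ω ^ 2 - p.2)) /
        ((1 / 2) ^ n) ^ 2) Filter.atTop (nhds 0) := by
  refine ae_tendsto_setIntegral_shiftRect P (Z := fun p ω => increment W p ω ^ 2 - p.2)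
    (((measurable_uncurry_increment hc hm).pow_const 2).sub (by fun_prop))
    gaussianSqVar_nonneg (fun r p hp => ?_) fun r p hp q hq hpq => ?_
  · have hl := hasLaw_increment hW hp
    have h1 := memLp_sq_sub_of_hasLaw_gaussianReal hl
    have h2 := integral_sq_sub_sq_of_hasLaw_gaussianReal hl
    rw [Real.coe_toNNReal _ hp.2.1] at h1 h2
    refine ⟨h1, h2.trans_le ?_⟩
    exact mul_le_mul_of_nonneg_left (pow_le_pow_left₀ hp.2.1 hp.2.2 2) gaussianSqVar_nonneg
  · rcases add_le_or_add_le_of_mem_shiftRect hp hq hpq with h | h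
    · exact integral_increment_sq_sub_mul hW hp hq h
    · simp_rw [mul_comm (increment W p _ ^ 2 - p.2)]
      exact integral_increment_sq_sub_mul hW hq hp h

lemma measurable_increment_apply (p : ℝ × ℝ) :
    Measurable fun w : ℝ≥0 → ℝ => w (p.1 + p.2).toNNReal - w p.1.toNNReal :=
  (measurable_pi_apply _).sub (measurable_pi_apply _)

/-- Off-diagonal entries: the products are already centred, and independence gives the second moment
`p.2 ^ 2`, hence `K = 1`. -/
lemma ae_tendsto_setIntegral_increment_mul [IsProbabilityMeasure P] {W W' : ℝ≥0 → Ω → ℝ}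
    (hW : IsPreBrownianReal W P) (hc : ∀ ω, Continuous (W · ω)) (hm : ∀ t, Measurable (W t))
    (hW' : IsPreBrownianReal W' P) (hc' : ∀ ω, Continuous (W' · ω)) (hm' : ∀ t, Measurable (W' t))
    (hind : IndepFun (fun ω t => W t ω) (fun ω t => W' t ω) P) :
    ∀ᵐ ω ∂P, Filter.Tendsto
      (fun n : ℕ => (∫ p in shiftRect ((1 / 2) ^ n), increment W p ω * increment W' p ω) /
        ((1 / 2) ^ n) ^ 2) Filter.atTop (nhds 0) := by
  -- Regrouped by process, the expectation factors into a `W` part and a `W'` part; the former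
  -- vanishes by independence of increments.
  have hzero : ∀ {r : ℝ} {p q : ℝ × ℝ}, p ∈ shiftRect r → q ∈ shiftRect r → p.1 + p.2 ≤ q.1 →
      ∫ ω, (increment W p ω * increment W' p ω) * (increment W q ω * increment W' q ω) ∂P = 0 := by
    intro r p q hp hq hpq
    have hmu : Measurable fun w : ℝ≥0 → ℝ => (w (p.1 + p.2).toNNReal - w p.1.toNNReal) *
        (w (q.1 + q.2).toNNReal - w q.1.toNNReal) :=
      (measurable_increment_apply p).mul (measurable_increment_apply q)
    have h := (hind.comp hmu hmu).integral_mul_eq_mul_integral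
      ((hasLaw_increment hW hp).aemeasurable.mul
        (hasLaw_increment hW hq).aemeasurable).aestronglyMeasurable
      ((hasLaw_increment hW' hp).aemeasurable.mul
        (hasLaw_increment hW' hq).aemeasurable).aestronglyMeasurable
    refine Eq.trans (integral_congr_ae (ae_of_all _ fun ω => ?_))
      (h.trans (mul_eq_zero_of_left (integral_increment_mul hW hp hq hpq) _))
    simp only [increment, Pi.mul_apply, Function.comp_apply]
    ring
  refine ae_tendsto_setIntegral_shiftRect P
    (Z := fun p ω => increment W p ω * increment W' p ω)
    ((measurable_uncurry_increment hc hm).mul (measurable_uncurry_increment hc' hm'))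
    zero_le_one (fun r p hp => ?_) fun r p hp q hq hpq => ?_
  · have hl := hasLaw_increment hW hp
    have hl' := hasLaw_increment hW' hp
    have hmu : Measurable fun w : ℝ≥0 → ℝ => (w (p.1 + p.2).toNNReal - w p.1.toNNReal) ^ 2 :=
      (measurable_increment_apply p).pow_const 2
    have hi := hind.comp hmu hmu
    have h1 := hi.integrable_mul (integrable_pow_of_hasLaw_gaussianReal hl 2)
      (integrable_pow_of_hasLaw_gaussianReal hl' 2)
    have h2 := hi.integral_mul_eq_mul_integral
      (hl.aemeasurable.pow_const 2).aestronglyMeasurable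
      (hl'.aemeasurable.pow_const 2).aestronglyMeasurable
    have h3 := h2.trans (congrArg₂ (· * ·) (integral_sq_of_hasLaw_gaussianReal hl)
      (integral_sq_of_hasLaw_gaussianReal hl'))
    simp_rw [mul_pow]
    refine ⟨?_, h3.trans_le ?_⟩
    · refine (memLp_two_iff_integrable_sq
        (hl.aemeasurable.mul hl'.aemeasurable).aestronglyMeasurable).2 ?_
      simp_rw [Pi.mul_apply, mul_pow]
      exact h1
    · rw [Real.coe_toNNReal _ hp.2.1, one_mul, ← sq]
      exact pow_le_pow_left₀ hp.2.1 hp.2.2 2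
  · rcases add_le_or_add_le_of_mem_shiftRect hp hq hpq with h | h
    · exact hzero hp hq h
    · simp_rw [mul_comm (increment W p _ * increment W' p _)]
      exact hzero hq hp h

end Increments

/-! ### Lower bound uniform in the direction -/

lemma integrableOn_shiftRect (r : ℝ) {φ : ℝ × ℝ → ℝ} (hφ : Continuous φ) :
    IntegrableOn φ (shiftRect r) :=
  hφ.continuousOn.integrableOn_compact (isCompact_Icc.prod isCompact_Icc)

lemma setIntegral_shiftRect_snd {r : ℝ} (hr : 0 ≤ r) : ∫ p in shiftRect r, p.2 = r ^ 2 / 4 := by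
  have h := setIntegral_prod_mul (μ := (volume : Measure ℝ)) (ν := (volume : Measure ℝ))
    (fun _ : ℝ => (1 : ℝ)) (fun v : ℝ => v) (Set.Icc 0 (1 / 2)) (Set.Icc 0 r)
  simp only [one_mul] at h
  refine h.trans ?_
  rw [integral_Icc_eq_integral_Ioc (x := 0) (y := r), ← intervalIntegral.integral_of_le hr,
    integral_id]
  simp
  ring

/-- The energy equals `r ^ 2 / 4`, the integral of the variance `p.2`, plus an error form whose
entries are `o(r ^ 2)`. The threshold in `n` precedes `lam`, so it serves the whole sphere. -/
lemma eventually_le_incEnergy {Ω : Type*} {d : ℕ} {W : Fin d → ℝ≥0 → Ω → ℝ} {ω : Ω}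
    (hc : ∀ i, Continuous (W i · ω))
    (hdiag : ∀ i, Filter.Tendsto
      (fun n : ℕ => (∫ p in shiftRect ((1 / 2) ^ n), (increment (W i) p ω ^ 2 - p.2)) /
        ((1 / 2) ^ n) ^ 2) Filter.atTop (nhds 0))
    (hoff : ∀ i j, i ≠ j → Filter.Tendsto
      (fun n : ℕ => (∫ p in shiftRect ((1 / 2) ^ n), increment (W i) p ω * increment (W j) p ω) /
        ((1 / 2) ^ n) ^ 2) Filter.atTop (nhds 0)) :
    ∀ᶠ n : ℕ in Filter.atTop, ∀ lam : Fin d → ℝ, ∑ i, lam i ^ 2 = 1 →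
      ENNReal.ofReal (((1 / 2) ^ n) ^ 2 / 8) ≤
        incEnergy ((1 / 2) ^ n) fun t => ∑ i, lam i * W i t.toNNReal ω := by
  have hlim : ∀ i j, Filter.Tendsto
      (fun n : ℕ => (∫ p in shiftRect ((1 / 2) ^ n), (increment (W i) p ω * increment (W j) p ω -
        if i = j then p.2 else 0)) / ((1 / 2) ^ n) ^ 2) Filter.atTop (nhds 0) := by
    intro i j
    by_cases h : i = j
    · subst h
      simpa [← sq] using hdiag i
    · simpa [h] using hoff i j h
  -- Since `(∑ |lam i|) ^ 2 ≤ d` on the sphere, this tolerance keeps the error below `r ^ 2 / 8`;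
  -- the `+ 1` keeps it positive when `d = 0`.
  have hev : ∀ᶠ n : ℕ in Filter.atTop, ∀ i j,
      |(∫ p in shiftRect ((1 / 2) ^ n), (increment (W i) p ω * increment (W j) p ω -
        if i = j then p.2 else 0)) / ((1 / 2) ^ n) ^ 2| < 1 / (8 * ((d : ℝ) + 1)) := by
    refine Filter.eventually_all.2 fun i => Filter.eventually_all.2 fun j => ?_
    have := ((tendsto_zero_iff_abs_tendsto_zero _).1 (hlim i j)).eventually_lt_const
      (show (0 : ℝ) < 1 / (8 * ((d : ℝ) + 1)) by positivity)
    exact this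
  filter_upwards [hev] with n hn lam hlam
  set r : ℝ := (1 / 2) ^ n with hr
  have hr0 : 0 < r := by positivity
  set X : Fin d → ℝ × ℝ → ℝ := fun i p => increment (W i) p ω with hX
  have hXc : ∀ i, Continuous (X i) := fun i => continuous_increment (hc i)
  have hinc : ∀ p : ℝ × ℝ, (∑ i, lam i * W i (p.1 + p.2).toNNReal ω) -
      ∑ i, lam i * W i p.1.toNNReal ω = ∑ i, lam i * X i p := by
    intro p
    rw [← Finset.sum_sub_distrib]
    exact Finset.sum_congr rfl fun i _ => (mul_sub _ _ _).symm
  have hsc : Continuous fun p => (∑ i, lam i * X i p) ^ 2 := by fun_prop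
  have henergy : (incEnergy r fun t => ∑ i, lam i * W i t.toNNReal ω) =
      ENNReal.ofReal (∫ p in shiftRect r, (∑ i, lam i * X i p) ^ 2) := by
    rw [ofReal_integral_eq_lintegral_ofReal (integrableOn_shiftRect r hsc)
      (ae_of_all _ fun _ => sq_nonneg _), incEnergy]
    refine lintegral_congr fun p => ?_
    rw [hinc, ← ofReal_norm, ENNReal.ofReal_rpow_of_nonneg (norm_nonneg _) (by norm_num),
      Real.rpow_two, Real.norm_eq_abs, sq_abs]
  rw [henergy]
  refine ENNReal.ofReal_le_ofReal ?_
  set D : Fin d → Fin d → ℝ := fun i j =>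
    ∫ p in shiftRect r, (X i p * X j p - if i = j then p.2 else 0)
  have hDb : ∀ i j, |D i j| ≤ r ^ 2 / (8 * (d + 1)) := by
    intro i j
    have h := (hn i j).le
    rw [abs_div, abs_of_pos (show 0 < r ^ 2 by positivity), div_le_iff₀ (by positivity)] at h
    exact h.trans_eq (by ring)
  have hdelta : ∀ i j : Fin d, Continuous fun p : ℝ × ℝ => if i = j then p.2 else 0 := by
    intro i j
    split_ifs <;> fun_prop
  have hexp : ∫ p in shiftRect r, (∑ i, lam i * X i p) ^ 2 =
      r ^ 2 / 4 + ∑ i, ∑ j, lam i * lam j * D i j := by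
    have hpt : ∀ p : ℝ × ℝ, (∑ i, lam i * X i p) ^ 2 =
        p.2 + ∑ i, ∑ j, lam i * lam j * (X i p * X j p - if i = j then p.2 else 0) := by
      intro p
      have e1 : ∑ i, ∑ j, lam i * lam j * (if i = j then p.2 else 0) = p.2 := by
        simp only [mul_ite, mul_zero, Finset.sum_ite_eq, Finset.mem_univ, if_true, ← sq]
        rw [← Finset.sum_mul, hlam, one_mul]
      simp_rw [mul_sub, Finset.sum_sub_distrib, e1]
      rw [sq, Finset.sum_mul_sum, add_sub_cancel]
      exact Finset.sum_congr rfl fun i _ => Finset.sum_congr rfl fun j _ => by ring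
    have hint : ∀ i j, IntegrableOn
        (fun p : ℝ × ℝ => lam i * lam j * (X i p * X j p - if i = j then p.2 else 0))
        (shiftRect r) := fun i j =>
      integrableOn_shiftRect r (continuous_const.mul (((hXc i).mul (hXc j)).sub (hdelta i j)))
    simp_rw [hpt]
    rw [integral_add (integrableOn_shiftRect r continuous_snd)
      (integrable_finsetSum _ fun i _ => integrable_finsetSum _ fun j _ => hint i j),
      setIntegral_shiftRect_snd hr0.le,
      integral_finsetSum _ fun i _ => integrable_finsetSum _ fun j _ => hint i j]
    congr 1
    refine Finset.sum_congr rfl fun i _ => ?_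
    rw [integral_finsetSum _ fun j _ => hint i j]
    exact Finset.sum_congr rfl fun j _ => integral_const_mul _ _
  have herr : |∑ i, ∑ j, lam i * lam j * D i j| ≤ r ^ 2 / 8 := by
    calc |∑ i, ∑ j, lam i * lam j * D i j|
        ≤ ∑ i, ∑ j, |lam i| * |lam j| * (r ^ 2 / (8 * (d + 1))) := by
          refine (Finset.abs_sum_le_sum_abs _ _).trans (Finset.sum_le_sum fun i _ =>
            (Finset.abs_sum_le_sum_abs _ _).trans (Finset.sum_le_sum fun j _ => ?_))
          rw [abs_mul, abs_mul]
          exact mul_le_mul_of_nonneg_left (hDb i j) (by positivity)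
      _ = (∑ i, |lam i|) ^ 2 * (r ^ 2 / (8 * (d + 1))) := by
          simp_rw [← Finset.sum_mul]
          rw [sq (∑ i, |lam i|), Finset.sum_mul_sum]
      _ ≤ d * (r ^ 2 / (8 * (d + 1))) := by
          refine mul_le_mul_of_nonneg_right ?_ (by positivity)
          have h := sq_sum_le_card_mul_sum_sq (s := Finset.univ) (f := fun i => |lam i|)
          simpa [hlam] using h
      _ ≤ r ^ 2 / 8 := by
          rw [← mul_div_assoc, div_le_div_iff₀ (by positivity) (by norm_num)]
          nlinarith [sq_nonneg r]
  rw [hexp]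
  linarith [(abs_le.1 herr).1]

/-! ### Conclusion -/

theorem mainTheorem6 {Ω : Type*} [MeasurableSpace Ω] (P : Measure Ω) [IsProbabilityMeasure P]
    (d : ℕ) (B : Fin d → ℝ≥0 → Ω → ℝ)
    (hB : ∀ i, IsBrownianReal (B i) P)
    (hindep : iIndepFun (fun (i : Fin d) (ω : Ω) (t : ℝ≥0) => B i t ω) P)
    (δ : ℝ) (hδ : 1 / 2 < δ) (hδ' : δ ≤ 1) :
    ∀ᵐ ω ∂P, ∃ C : ℝ, 0 < C ∧ ∀ h : ℝ → ℝ, MemH δ h →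
      ENNReal.ofReal C * (1 / (1 + sobolevSeminorm δ h)) ≤
        ⨅ (c : ℝ) (lam : Fin d → ℝ) (_ : ∑ i, lam i ^ 2 = 1),
          sobolevSeminorm (1 - δ)
            (fun t => ∑ i, lam i * B i t.toNNReal ω - h t - c) := by
  choose W hWc hWm hWB using fun i =>
    exists_continuous_modification (hB i).aemeasurable (hB i).cont
  have hW : ∀ i, IsPreBrownianReal (W i) P := fun i =>
    (hB i).toIsPreBrownianReal.congr fun t => (hWB i).mono fun ω h => h t
  have hWind : iIndepFun (fun (i : Fin d) (ω : Ω) (t : ℝ≥0) => W i t ω) P :=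
    hindep.congr fun i => (hWB i).mono fun ω h => funext h
  have hdiag := ae_all_iff.2 fun i =>
    ae_tendsto_setIntegral_increment_sq (hW i) (hWc i) (hWm i)
  have hoff := ae_all_iff.2 fun i => ae_all_iff.2 fun j => ae_all_iff.2 fun hij : i ≠ j =>
    ae_tendsto_setIntegral_increment_mul (hW i) (hWc i) (hWm i)
      (hW j) (hWc j) (hWm j) (hWind.indepFun hij)
  filter_upwards [hdiag, hoff, ae_all_iff.2 hWB] with ω h1 h2 h3
  obtain ⟨N, hN⟩ := Filter.eventually_atTop.1
    (eventually_le_incEnergy (W := W) (fun i => hWc i ω) h1 h2)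
  -- The random threshold `N` is what makes `C` depend on the realisation. Passing to `N + 1`
  -- ensures `r ≤ 1 / 2`.
  obtain ⟨C, hC, hCb⟩ := exists_le_sobolevSeminorm hδ hδ' (N + 1) (by omega)
  refine ⟨C, hC, fun h hh => le_iInf fun c => le_iInf fun lam => le_iInf fun hlam => ?_⟩
  simp_rw [h3]
  refine hCb (fun t => ∑ i, lam i * W i t.toNNReal ω) ?_ (fun n hn => hN n (by omega) lam hlam)
    h hh c
  have hcont : Continuous fun t : ℝ => ∑ i, lam i * W i t.toNNReal ω :=
    continuous_finsetSum _ fun i _ =>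
      continuous_const.mul ((hWc i ω).comp continuous_real_toNNReal)
  exact hcont.aemeasurable
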